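/- Let $n\ge 2$, let $p\in[2,\infty)$ and let $q\in(1,2]$ be given by $\frac1p+\frac1q=1$. Let $(x^{(i)},y^{(i)})_{i=1}^n$ be examples with $x^{(i)}\in\mathbb{R}^d$, $\|x^{(i)}\|_p\le 1$ and $y^{(i)}\in\{-1,1\}$, let $A\in\mathbb{R}^{n\times d}$ be the matrix with rows $y^{(i)}x^{(i)}$, let $\Delta^n$ be the probability simplex in $\mathbb{R}^n$, and call $m(w)=\min_{\pi\in\Delta^n}\pi^\top A w$ the margin of $w\in\mathbb{R}^d$. Assume that $\gamma>0$ and that there is $w^*\in\mathbb{R}^d$ with $\|w^*\|_q\le 1$ and $m(w^*)\ge\gamma$. For a differentiable $R$ let $D_R(z,z')=R(z)-R(z')-\nabla R(z')^\top(z-z')$, and let $E(\pi)=\sum_{i=1}^n\pi_i\log\pi_i$. Put $\pi_0=\frac{\mathbf 1}{n}$, $h_t(w)=-\pi_t^\top A w$, $\ell_t(\pi)=\pi^\top A w_t$, $\alpha_t=1$, $\eta^w=\sqrt{\frac{1}{2(q-1)\log n}}$ and $\eta^p=\frac{1}{\eta^w}$, and consider the algorithm which in rounds $t=1,\dots,T$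 chooses first $$w_t\in\operatorname*{argmin}_{w\in\mathbb{R}^d}\ \eta^w\Big[\sum_{j=1}^{t-1}\alpha_jh_j(w)+\alpha_th_{t-1}(w)\Big]+D_{\frac{1}{2(q-1)}\|\cdot\|_q^2}(w,\mathbf 0)$$ and then $$\pi_t\in\operatorname*{argmin}_{\pi\in\Delta^n}\ \eta^p\sum_{s=1}^{t}\alpha_s\ell_s(\pi)+D_E\big(\pi,\tfrac{\mathbf 1}{n}\big),$$ and outputs $\overline w_T=\frac{1}{\sum_{t=1}^T\alpha_t}\sum_{t=1}^T\alpha_tw_t$. If $T\ge\frac{\sqrt{2(p-1)\log n}}{\gamma}$, then the algorithm can be run for $T$ rounds (all the minimizers exist), and its output satisfies $m(\overline w_T)\ge 0$, that is, $\overline w_T$ has a non-negative margin. -/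

import Mathlib

namespace PNormPerceptron

noncomputable section

open scoped Matrix

/-- The `ℓ_r`-norm on `ℝ^d` for a real exponent `r ≥ 1`, i.e. `(∑ |v_i|^r)^(1/r)`. -/
def lpNorm {d : ℕ} (r : ℝ) (v : Fin d → ℝ) : ℝ :=
  ‖WithLp.toLp (ENNReal.ofReal r) v‖

/-- The data matrix `A`, whose `i`-th row is `y⁽ⁱ⁾ x⁽ⁱ⁾`. -/
def dataMatrix {n d : ℕ} (x : Fin n → Fin d → ℝ) (y : Fin n → ℝ) : Matrix (Fin n) (Fin d) ℝ :=
  Matrix.of fun i j => y i * x i j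

/-- The payoff `g(w, p) = pᵀ A w` of the two-player game. -/
def payoff {n d : ℕ} (A : Matrix (Fin n) (Fin d) ℝ) (w : Fin d → ℝ) (p : Fin n → ℝ) : ℝ :=
  p ⬝ᵥ (A *ᵥ w)

/-- The margin `γ(w) = min_{p ∈ Δⁿ} pᵀ A w`.  For `n ≥ 1` the simplex is compact and non-empty,
so that the infimum is attained. -/
def margin {n d : ℕ} (A : Matrix (Fin n) (Fin d) ℝ) (w : Fin d → ℝ) : ℝ :=
  sInf ((fun p => payoff A w p) '' stdSimplex ℝ (Fin n))

/-- The Bregman divergence `D_R(z, z') = R(z) - R(z') - ⟨∇R(z'), z - z'⟩`. -/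
def bregman {m : ℕ} (R : (Fin m → ℝ) → ℝ) (z z' : Fin m → ℝ) : ℝ :=
  R z - R z' - fderiv ℝ R z' (z - z')

/-- The negative entropy `E(p) = ∑ p_i log p_i`. -/
def negEntropy {n : ℕ} (p : Fin n → ℝ) : ℝ :=
  ∑ i, p i * Real.log (p i)

/-- The regularizer `‖·‖_q² / (2 (q - 1))`. -/
def qReg {d : ℕ} (q : ℝ) (w : Fin d → ℝ) : ℝ :=
  1 / (2 * (q - 1)) * lpNorm q w ^ 2

/-- The uniform distribution `𝟏/n`. -/
def uniform (n : ℕ) : Fin n → ℝ := fun _ => 1 / (n : ℝ)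

/-- `z ∈ argmin_{u ∈ Z} F(u)`. -/
def IsArgmin {m : ℕ} (F : (Fin m → ℝ) → ℝ) (Z : Set (Fin m → ℝ)) (z : Fin m → ℝ) : Prop :=
  z ∈ Z ∧ ∀ u ∈ Z, F z ≤ F u

/-- `z` is a round-`t` decision of `OFTRL[R, z₀, ψ_t, η, Z]` with weights `α` and losses `f`:
`z ∈ argmin_{u ∈ Z} η [∑_{j=1}^{t-1} α_j f_j(u) + α_t ψ_t(u)] + D_R(u, z₀)`. -/
def IsOFTRL {m : ℕ} (R : (Fin m → ℝ) → ℝ) (z₀ : Fin m → ℝ) (ψ : (Fin m → ℝ) → ℝ) (η : ℝ)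
    (Z : Set (Fin m → ℝ)) (α : ℕ → ℝ) (f : ℕ → (Fin m → ℝ) → ℝ) (t : ℕ) (z : Fin m → ℝ) : Prop :=
  IsArgmin (fun u => η * (∑ j ∈ Finset.Ico 1 t, α j * f j u + α t * ψ u) + bregman R u z₀) Z z

/-- `z` is a round-`t` decision of `FTRL⁺[R, z₀, η, Z]` with weights `α` and losses `f`:
`z ∈ argmin_{u ∈ Z} η ∑_{j=1}^{t} α_j f_j(u) + D_R(u, z₀)`. -/
def IsFTRLPlus {m : ℕ} (R : (Fin m → ℝ) → ℝ) (z₀ : Fin m → ℝ) (η : ℝ)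
    (Z : Set (Fin m → ℝ)) (α : ℕ → ℝ) (f : ℕ → (Fin m → ℝ) → ℝ) (t : ℕ) (z : Fin m → ℝ) : Prop :=
  IsArgmin (fun u => η * ∑ j ∈ Finset.Icc 1 t, α j * f j u + bregman R u z₀) Z z

/-- `w_1, …, w_T` and `p_0, …, p_T` are the iterates of a `T`-round run of the algorithm.  The
losses are `h_t = -g(·, p_t)` for the `w`-player and `ℓ_t = g(w_t, ·)` for the `p`-player.  In
round `t` the `w`-player moves first, by OFTRL with hint `h_{t-1}`; the `p`-player then observes
`ℓ_t` and moves by FTRL⁺.  (The value `w 0` is not used.) -/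
structure IsRun {n d : ℕ} (A : Matrix (Fin n) (Fin d) ℝ) (q ηw ηp : ℝ) (α : ℕ → ℝ) (T : ℕ)
    (w : ℕ → Fin d → ℝ) (p : ℕ → Fin n → ℝ) : Prop where
  init : p 0 = uniform n
  w_step : ∀ t ∈ Finset.Icc 1 T,
    IsOFTRL (qReg q) 0 (fun u => -payoff A u (p (t - 1))) ηw Set.univ α
      (fun j u => -payoff A u (p j)) t (w t)
  p_step : ∀ t ∈ Finset.Icc 1 T,
    IsFTRLPlus negEntropy (uniform n) ηp (stdSimplex ℝ (Fin n)) α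
      (fun j u => payoff A (w j) u) t (p t)

/-- The weighted average `(∑_{t=1}^T α_t)⁻¹ ∑_{t=1}^T α_t w_t`. -/
def average {d : ℕ} (α : ℕ → ℝ) (T : ℕ) (w : ℕ → Fin d → ℝ) : Fin d → ℝ :=
  (∑ t ∈ Finset.Icc 1 T, α t)⁻¹ • ∑ t ∈ Finset.Icc 1 T, α t • w t

end

end PNormPerceptron

namespace PNormPerceptron

open scoped Matrix
open Finset

/-! ### Hölder duality for ℓ_p norms and the conjugate pair `pPotential`, `qReg`. -/

section LpNorm

variable {d : ℕ}

/-! Let Φ be `pPotential p`, let η = ηw, and let F_t be the minimum over the simplex of ⟨L_t, ·⟩/η +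
E, where L_t = ∑_{j≤t} A w_j. The proof compares Φ(η ∑_{j≤t} Aᵀπ_j) with η²(F_t + log n). The hint
of the w-player guesses π_{t+1} = π_t. Since Φ is 1-smooth for ‖·‖_p (`pPotential_add_le`) and the
rows of A have p-norm at most 1, a wrong guess costs at most η²‖π_{t+1} - π_t‖₁²/2. Since entropy is
strongly convex in ℓ₁ (`add_sq_le_dotProduct_add_negEntropy`, from Pinsker), η²F_t gains at least
this amount besides the payoff of the round. As ηp = 1/ηw the two terms cancel, so Φ ≤ η²(F_t + log
n) by induction (`pPotential_le_of_isRun`). Fenchel–Young at the comparator c·w* bounds Φ below, and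
any v in the simplex bounds F_T above. Hence η ∑ vᵀA w_t ≥ ηTcγ - (p-1)c²/2 - η² log n. The w-player
is unconstrained, so c is free; the best c gives η²((Tγ)²/(2(p-1)) - log n), whose sign does not
depend on η. -/

theorem lpNorm_eq_sum {r : ℝ} (hr : 0 < r) (v : Fin d → ℝ) :
    lpNorm r v = (∑ i, |v i| ^ r) ^ (1 / r) := by
  have h : (ENNReal.ofReal r).toReal = r := ENNReal.toReal_ofReal hr.le
  rw [lpNorm, PiLp.norm_eq_sum (by rw [h]; exact hr), h]
  simp [Real.norm_eq_abs]

theorem fact_one_le_ofReal {r : ℝ} (hr : 1 ≤ r) : Fact (1 ≤ ENNReal.ofReal r) :=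
  ⟨by simpa using hr⟩

theorem lpNorm_nonneg {r : ℝ} (hr : 1 ≤ r) (v : Fin d → ℝ) : 0 ≤ lpNorm r v := by
  have := fact_one_le_ofReal hr
  exact norm_nonneg _

theorem lpNorm_zero {r : ℝ} (hr : 1 ≤ r) : lpNorm r (0 : Fin d → ℝ) = 0 := by
  have := fact_one_le_ofReal hr
  simp [lpNorm]

theorem lpNorm_eq_zero {r : ℝ} (hr : 1 ≤ r) {v : Fin d → ℝ} : lpNorm r v = 0 ↔ v = 0 := by
  have := fact_one_le_ofReal hr
  simp [lpNorm]

theorem lpNorm_smul {r : ℝ} (hr : 1 ≤ r) (c : ℝ) (v : Fin d → ℝ) :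
    lpNorm r (c • v) = |c| * lpNorm r v := by
  have := fact_one_le_ofReal hr
  rw [lpNorm, WithLp.toLp_smul, norm_smul, Real.norm_eq_abs, lpNorm]

theorem lpNorm_sum_smul_le {r : ℝ} (hr : 1 ≤ r) {ι : Type*} (s : Finset ι) (c : ι → ℝ)
    (v : ι → Fin d → ℝ) : lpNorm r (∑ i ∈ s, c i • v i) ≤ ∑ i ∈ s, |c i| * lpNorm r (v i) := by
  have := fact_one_le_ofReal hr
  calc lpNorm r (∑ i ∈ s, c i • v i) = ‖∑ i ∈ s, WithLp.toLp (ENNReal.ofReal r) (c i • v i)‖ := by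
        rw [lpNorm, WithLp.toLp_sum]
    _ ≤ ∑ i ∈ s, ‖WithLp.toLp (ENNReal.ofReal r) (c i • v i)‖ := norm_sum_le _ _
    _ = ∑ i ∈ s, |c i| * lpNorm r (v i) :=
        sum_congr rfl fun i _ => lpNorm_smul hr (c i) (v i)

theorem lpNorm_sq_eq {r : ℝ} (hr : 0 < r) (v : Fin d → ℝ) :
    lpNorm r v ^ 2 = (∑ i, |v i| ^ r) ^ (2 / r) := by
  rw [lpNorm_eq_sum hr, ← Real.rpow_natCast,
    ← Real.rpow_mul (sum_nonneg fun i _ => by positivity)]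
  congr 1
  push_cast
  ring

theorem dotProduct_le_lpNorm_mul {p q : ℝ} (hpq : p.HolderConjugate q) (u v : Fin d → ℝ) :
    u ⬝ᵥ v ≤ lpNorm p u * lpNorm q v := by
  rw [lpNorm_eq_sum hpq.pos, lpNorm_eq_sum hpq.symm.pos]
  exact Real.inner_le_Lp_mul_Lq _ _ _ hpq

/-- Equality case of Hölder: take the nonnegative maximizer for |u| and restore the signs of u.
Coordinates with u i = 0 are set to 0, so the norm can only shrink. -/
theorem exists_dotProduct_eq_lpNorm {p q : ℝ} (hpq : p.HolderConjugate q) (u : Fin d → ℝ) :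
    ∃ v : Fin d → ℝ, lpNorm q v ≤ 1 ∧ u ⬝ᵥ v = lpNorm p u := by
  obtain ⟨g, hg, hgu⟩ := (NNReal.isGreatest_Lp univ (fun i => ‖u i‖₊) hpq).1
  have hq := hpq.symm.pos
  refine ⟨fun i => SignType.sign (u i) * (g i : ℝ), ?_, ?_⟩
  · rw [lpNorm_eq_sum hq]
    refine Real.rpow_le_one (sum_nonneg fun i _ => by positivity) ?_ (by positivity)
    have h1 : (∑ i, (g i : ℝ) ^ q) ≤ 1 := by exact_mod_cast hg
    refine le_trans (sum_le_sum fun i _ => ?_) h1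
    refine Real.rpow_le_rpow (abs_nonneg _) ?_ hq.le
    rw [abs_mul, abs_of_nonneg (g i).coe_nonneg]
    refine mul_le_of_le_one_left (g i).coe_nonneg ?_
    rcases lt_trichotomy (u i) 0 with h | h | h <;> simp [h]
  · rw [lpNorm_eq_sum hpq.pos]
    have h2 := congrArg NNReal.toReal hgu
    push_cast at h2
    simp only [Real.norm_eq_abs] at h2
    rw [← h2, dotProduct]
    refine sum_congr rfl fun i _ => ?_
    rw [← mul_assoc, self_mul_sign]

/-- The Fenchel conjugate `‖·‖_p² / (2 (p - 1))` of `qReg q`. -/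
noncomputable def pPotential (p : ℝ) (u : Fin d → ℝ) : ℝ :=
  lpNorm p u ^ 2 / (2 * (p - 1))

theorem pPotential_zero {p : ℝ} (hp : 1 ≤ p) : pPotential p (0 : Fin d → ℝ) = 0 := by
  simp [pPotential, lpNorm_zero hp]

theorem qReg_eq {p q : ℝ} (hpq : p.HolderConjugate q) (v : Fin d → ℝ) :
    qReg q v = (p - 1) / 2 * lpNorm q v ^ 2 := by
  have h1 := hpq.sub_one_pos
  have h2 := hpq.symm.sub_one_pos
  have h3 : (p - 1) * (q - 1) = 1 := by linarith [hpq.mul_eq_add]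
  rw [qReg]
  congr 1
  field_simp
  linarith

theorem dotProduct_le_pPotential_add_qReg {p q : ℝ} (hpq : p.HolderConjugate q)
    (u v : Fin d → ℝ) : u ⬝ᵥ v ≤ pPotential p u + qReg q v := by
  have h1 := hpq.sub_one_pos
  refine (dotProduct_le_lpNorm_mul hpq u v).trans ?_
  rw [qReg_eq hpq, pPotential, ← sub_nonneg]
  have : lpNorm p u ^ 2 / (2 * (p - 1)) + (p - 1) / 2 * lpNorm q v ^ 2
      - lpNorm p u * lpNorm q v = (lpNorm p u - (p - 1) * lpNorm q v) ^ 2 / (2 * (p - 1)) := by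
    field_simp
    ring
  rw [this]
  positivity

theorem exists_dotProduct_eq_pPotential_add_qReg {p q : ℝ} (hpq : p.HolderConjugate q)
    (u : Fin d → ℝ) : ∃ v : Fin d → ℝ, u ⬝ᵥ v = pPotential p u + qReg q v := by
  have h1 := hpq.sub_one_pos
  obtain ⟨v, hv, huv⟩ := exists_dotProduct_eq_lpNorm hpq u
  -- This scale maximizes c‖u‖_p - (p-1)c²/2 over c.
  refine ⟨(lpNorm p u / (p - 1)) • v,
    le_antisymm (dotProduct_le_pPotential_add_qReg hpq _ _) ?_⟩
  rw [dotProduct_smul, huv, qReg_eq hpq, lpNorm_smul hpq.symm.lt.le, pPotential, mul_pow, sq_abs]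
  have h2 : lpNorm q v ^ 2 ≤ 1 := pow_le_one₀ (lpNorm_nonneg hpq.symm.lt.le v) hv
  calc lpNorm p u ^ 2 / (2 * (p - 1))
        + (p - 1) / 2 * ((lpNorm p u / (p - 1)) ^ 2 * lpNorm q v ^ 2)
      ≤ lpNorm p u ^ 2 / (2 * (p - 1)) + (p - 1) / 2 * ((lpNorm p u / (p - 1)) ^ 2 * 1) := by
        gcongr
    _ = (lpNorm p u / (p - 1)) • lpNorm p u := by
        rw [smul_eq_mul]
        field_simp
        ring

end LpNorm

/-! ### Smoothness of the squared p-norm. -/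

section Smoothness

/-- With r = p - 2 this supplies the second derivative of |x|^p. At 0 the difference quotient is
|y|^r itself; the convention 0^0 = 1 makes r = 0 fit. -/
theorem hasDerivAt_abs_rpow_mul_self {r : ℝ} (hr : 0 ≤ r) (x : ℝ) :
    HasDerivAt (fun x : ℝ => |x| ^ r * x) ((r + 1) * |x| ^ r) x := by
  rcases lt_trichotomy x 0 with hx | rfl | hx
  · have h : HasDerivAt (fun x : ℝ => -(-x) ^ (r + 1)) ((r + 1) * |x| ^ r) x := by
      have := ((hasDerivAt_neg x).rpow_const (p := r + 1) (Or.inl (by simpa using hx.ne))).neg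
      refine this.congr_deriv ?_
      rw [abs_of_neg hx, add_sub_cancel_right]
      ring
    refine h.congr_of_eventuallyEq ?_
    filter_upwards [eventually_lt_nhds hx] with y hy
    rw [abs_of_neg hy, Real.rpow_add_one (by linarith : -y ≠ 0)]
    ring
  · rw [hasDerivAt_iff_tendsto_slope]
    have h : Filter.Tendsto (fun x : ℝ => |x| ^ r) (nhdsWithin 0 {0}ᶜ) (nhds (|0| ^ r)) :=
      ((Real.continuous_rpow_const hr).comp continuous_abs).continuousAt.tendsto.mono_left
        nhdsWithin_le_nhds
    have hval : (r + 1) * |(0 : ℝ)| ^ r = |(0 : ℝ)| ^ r := by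
      rcases hr.eq_or_lt with rfl | h0
      · simp
      · simp [Real.zero_rpow h0.ne']
    rw [hval]
    refine h.congr' ?_
    filter_upwards [self_mem_nhdsWithin] with y hy
    have : y ≠ 0 := hy
    simp [slope_def_field, this]
  · have h : HasDerivAt (fun x : ℝ => x ^ (r + 1)) ((r + 1) * |x| ^ r) x := by
      have := (hasDerivAt_id x).rpow_const (p := r + 1) (Or.inl (by simpa using hx.ne'))
      refine this.congr_deriv ?_
      rw [abs_of_pos hx]
      simp
    refine h.congr_of_eventuallyEq ?_
    filter_upwards [eventually_gt_nhds hx] with y hy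
    rw [abs_of_pos hy, Real.rpow_add_one (by linarith : y ≠ 0)]

variable {d : ℕ}

/-- Hölder with exponents p/(p-2) and p/2; for p = 2 the first is infinite and both sides agree. -/
theorem sum_abs_rpow_mul_sq_le {p : ℝ} (hp : 2 ≤ p) (v b : Fin d → ℝ) :
    ∑ i, |v i| ^ (p - 2) * b i ^ 2 ≤ (∑ i, |v i| ^ p) ^ (1 - 2 / p) * lpNorm p b ^ 2 := by
  rw [lpNorm_sq_eq (by linarith)]
  rcases hp.eq_or_lt with rfl | hp
  · simp
  have hc : (p / (p - 2)).HolderConjugate (p / 2) := by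
    rw [Real.holderConjugate_iff]
    refine ⟨by rw [lt_div_iff₀] <;> linarith, ?_⟩
    have : p - 2 ≠ 0 := by linarith
    field_simp
    ring
  have h := Real.inner_le_Lp_mul_Lq_of_nonneg (s := univ) (f := fun i => |v i| ^ (p - 2))
    (g := fun i => b i ^ 2) hc (fun i _ => by positivity) (fun i _ => by positivity)
  refine h.trans (le_of_eq ?_)
  have e1 : ∀ i, (|v i| ^ (p - 2)) ^ (p / (p - 2)) = |v i| ^ p := fun i => by
    rw [← Real.rpow_mul (abs_nonneg _), mul_div_cancel₀ _ (by linarith : p - 2 ≠ 0)]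
  have e2 : ∀ i, (b i ^ 2) ^ (p / 2) = |b i| ^ p := fun i => by
    rw [← sq_abs, ← Real.rpow_natCast, ← Real.rpow_mul (abs_nonneg _)]
    congr 1
    push_cast
    ring
  simp only [e1, e2]
  congr 2
  · field_simp
  · field_simp

/-- Along a line avoiding the origin, `‖·‖_p²` has second derivative at most
`2 (p - 1) ‖b‖_p²`. -/
theorem concaveOn_lpNorm_sq_line_of_ne {p : ℝ} (hp : 2 ≤ p) (a b : Fin d → ℝ)
    (hne : ∀ t : ℝ, a + t • b ≠ 0) :
    ConcaveOn ℝ Set.univ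
      (fun t : ℝ => lpNorm p (a + t • b) ^ 2 - (p - 1) * lpNorm p b ^ 2 * t ^ 2) := by
  have hp0 : 0 < p := by linarith
  set N : ℝ → ℝ := fun t => ∑ i, |a i + t * b i| ^ p with hN
  set M : ℝ → ℝ := fun t => ∑ i, |a i + t * b i| ^ (p - 2) * (a i + t * b i) * b i with hM
  set K : ℝ → ℝ := fun t => ∑ i, |a i + t * b i| ^ (p - 2) * b i ^ 2 with hK
  have hNpos : ∀ t, 0 < N t := fun t => by
    have h0 : 0 ≤ N t := sum_nonneg fun i _ => by positivity
    refine h0.lt_of_ne' fun h => hne t ?_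
    rw [← lpNorm_eq_zero (r := p) (by linarith), lpNorm_eq_sum hp0]
    have : ∑ i, |(a + t • b) i| ^ p = 0 := h
    rw [this, Real.zero_rpow (by positivity)]
  have hline : ∀ i t, HasDerivAt (fun t : ℝ => a i + t * b i) (b i) t := fun i t => by
    simpa using ((hasDerivAt_id t).mul_const (b i)).const_add (a i)
  have hN' : ∀ t, HasDerivAt N (p * M t) t := fun t => by
    rw [hM, mul_sum]
    refine HasDerivAt.fun_sum fun i _ => ?_
    have := (hasDerivAt_abs_rpow (a i + t * b i) (by linarith : 1 < p)).comp t (hline i t)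
    refine this.congr_deriv ?_
    ring
  have hM' : ∀ t, HasDerivAt M ((p - 1) * K t) t := fun t => by
    rw [hK, mul_sum]
    refine HasDerivAt.fun_sum fun i _ => ?_
    have := ((hasDerivAt_abs_rpow_mul_self (by linarith : 0 ≤ p - 2) (a i + t * b i)).comp t
      (hline i t)).mul_const (b i)
    refine this.congr_deriv ?_
    ring
  have hfun : (fun t : ℝ => lpNorm p (a + t • b) ^ 2 - (p - 1) * lpNorm p b ^ 2 * t ^ 2)
      = fun t => N t ^ (2 / p) - (p - 1) * lpNorm p b ^ 2 * t ^ 2 := by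
    funext t
    rw [lpNorm_sq_eq hp0]
    rfl
  rw [hfun]
  have hf' : ∀ t, HasDerivAt (fun t => N t ^ (2 / p) - (p - 1) * lpNorm p b ^ 2 * t ^ 2)
      (2 * (M t * N t ^ (2 / p - 1)) - (p - 1) * lpNorm p b ^ 2 * (2 * t)) t := fun t => by
    have h1 := (hN' t).rpow_const (p := 2 / p) (Or.inl (hNpos t).ne')
    have h2 := (hasDerivAt_pow 2 t).const_mul ((p - 1) * lpNorm p b ^ 2)
    refine (h1.sub h2).congr_deriv ?_
    field_simp
    ring
  have hf'' : ∀ t, HasDerivAt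
      (fun t => 2 * (M t * N t ^ (2 / p - 1)) - (p - 1) * lpNorm p b ^ 2 * (2 * t))
      (2 * ((p - 1) * K t * N t ^ (2 / p - 1)
        + M t * (p * M t * (2 / p - 1) * N t ^ (2 / p - 1 - 1)))
        - (p - 1) * lpNorm p b ^ 2 * 2) t := fun t => by
    have h1 := (hN' t).rpow_const (p := 2 / p - 1) (Or.inl (hNpos t).ne')
    have h2 := ((hasDerivAt_id t).const_mul 2).const_mul ((p - 1) * lpNorm p b ^ 2)
    refine ((((hM' t).mul h1).const_mul 2).sub h2).congr_deriv ?_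
    ring
  refine concaveOn_of_hasDerivWithinAt2_nonpos convex_univ
    (fun t _ => (hf' t).continuousAt.continuousWithinAt)
    (fun t _ => (hf' t).hasDerivWithinAt) (fun t _ => (hf'' t).hasDerivWithinAt) fun t _ => ?_
  have hKle : K t * N t ^ (2 / p - 1) ≤ lpNorm p b ^ 2 := by
    have h := sum_abs_rpow_mul_sq_le hp (a + t • b) b
    have hmul : N t ^ (1 - 2 / p) * N t ^ (2 / p - 1) = 1 := by
      rw [← Real.rpow_add (hNpos t)]
      simp
    calc K t * N t ^ (2 / p - 1)
        ≤ (N t ^ (1 - 2 / p) * lpNorm p b ^ 2) * N t ^ (2 / p - 1) :=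
          mul_le_mul_of_nonneg_right h (Real.rpow_nonneg (hNpos t).le _)
      _ = (N t ^ (1 - 2 / p) * N t ^ (2 / p - 1)) * lpNorm p b ^ 2 := by ring
      _ = lpNorm p b ^ 2 := by rw [hmul, one_mul]
  -- Differentiating the outer power contributes a square times 2/p - 1, which is nonpositive
  -- because p ≥ 2.
  have hneg : M t * (p * M t * (2 / p - 1) * N t ^ (2 / p - 1 - 1)) ≤ 0 := by
    have h1 : 2 / p - 1 ≤ 0 := by
      rw [sub_nonpos, div_le_one hp0]
      exact hp
    have h2 : 0 ≤ p * M t ^ 2 * N t ^ (2 / p - 1 - 1) :=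
      mul_nonneg (by positivity) (Real.rpow_nonneg (hNpos t).le _)
    nlinarith [mul_nonneg h2 (neg_nonneg.2 h1)]
  have := mul_le_mul_of_nonneg_left hKle (by linarith : 0 ≤ p - 1)
  linarith

/-- On a line through the origin the squared norm is (t - s)²‖b‖_p², with leading coefficient at
most that of the subtracted quadratic since 1 ≤ p - 1. -/
theorem concaveOn_lpNorm_sq_line {p : ℝ} (hp : 2 ≤ p) (a b : Fin d → ℝ) :
    ConcaveOn ℝ Set.univ
      (fun t : ℝ => lpNorm p (a + t • b) ^ 2 - (p - 1) * lpNorm p b ^ 2 * t ^ 2) := by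
  by_cases hne : ∀ t : ℝ, a + t • b ≠ 0
  · exact concaveOn_lpNorm_sq_line_of_ne hp a b hne
  push Not at hne
  obtain ⟨s, hs⟩ := hne
  have ha : a = -(s • b) := eq_neg_of_add_eq_zero_left hs
  have hfun : ∀ t : ℝ, lpNorm p (a + t • b) ^ 2 = (t - s) ^ 2 * lpNorm p b ^ 2 := fun t => by
    rw [ha, neg_add_eq_sub, ← sub_smul, lpNorm_smul (by linarith), mul_pow, sq_abs]
  refine ⟨convex_univ, fun x _ y _ c e hc he hce => ?_⟩
  simp only [hfun, smul_eq_mul]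
  obtain rfl : e = 1 - c := by linarith
  have h : 0 ≤ (p - 2) * lpNorm p b ^ 2 * (c * (1 - c) * (x - y) ^ 2) :=
    mul_nonneg (mul_nonneg (by linarith) (sq_nonneg _)) (by positivity)
  nlinarith [h]

/-- A real function which is concave up to a quadratic lies below the quadratic
built from any of its subgradients. -/
theorem le_of_concaveOn_sub_sq_of_subgradient {f : ℝ → ℝ} {c s : ℝ}
    (hf : ConcaveOn ℝ Set.univ (fun t => f t - c * t ^ 2)) (hs : ∀ t, f 0 + t * s ≤ f t) :
    f 1 ≤ f 0 + s + c := by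
  -- Concavity at 0, a convex combination of 1 and -ε, bounds f 1 by f 0 and f (-ε); the subgradient
  -- bounds f (-ε) below. Letting ε → 0 avoids differentiating f.
  have key : ∀ ε : ℝ, 0 < ε → f 1 ≤ f 0 + s + c + c * ε := fun ε hε => by
    have h1 : (0 : ℝ) < 1 + ε := by linarith
    have h := hf.right (Set.mem_univ 1) (Set.mem_univ (-ε)) (by positivity : 0 ≤ ε / (1 + ε))
      (by positivity : 0 ≤ 1 / (1 + ε)) (by field_simp; ring)
    have h0 : (ε / (1 + ε)) • (1 : ℝ) + (1 / (1 + ε)) • (-ε) = 0 := by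
      simp only [smul_eq_mul]
      field_simp
      ring
    rw [h0] at h
    simp only [smul_eq_mul] at h
    have h2 := hs (-ε)
    have h3 : ε * (f 1 - c * 1 ^ 2) + (f (-ε) - c * (-ε) ^ 2)
        ≤ (1 + ε) * (f 0 - c * 0 ^ 2) := by
      have := mul_le_mul_of_nonneg_left h h1.le
      refine le_trans (le_of_eq ?_) this
      field_simp
    have h4 : ε * f 1 ≤ ε * (f 0 + s + c + c * ε) := by nlinarith
    exact le_of_mul_le_mul_left h4 hε
  have hlim : Filter.Tendsto (fun ε : ℝ => f 0 + s + c + c * ε) (nhdsWithin 0 (Set.Ioi 0))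
      (nhds (f 0 + s + c + c * 0)) :=
    (Continuous.tendsto (by fun_prop) 0).mono_left nhdsWithin_le_nhds
  have := ge_of_tendsto hlim (Filter.eventually_of_mem self_mem_nhdsWithin key)
  simpa using this

/-- `pPotential p` is `1`-smooth with respect to `‖·‖_p`. -/
theorem pPotential_add_le {p q : ℝ} (hp : 2 ≤ p) (hpq : p.HolderConjugate q)
    {a w : Fin d → ℝ} (hw : a ⬝ᵥ w = pPotential p a + qReg q w) (b : Fin d → ℝ) :
    pPotential p (a + b) ≤ pPotential p a + b ⬝ᵥ w + lpNorm p b ^ 2 / 2 := by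
  have h1 : 0 < 2 * (p - 1) := by linarith
  have hc : ConcaveOn ℝ Set.univ
      (fun t : ℝ => pPotential p (a + t • b) - lpNorm p b ^ 2 / 2 * t ^ 2) := by
    have := (concaveOn_lpNorm_sq_line hp a b).smul (c := 1 / (2 * (p - 1))) (by positivity)
    refine this.congr fun t _ => ?_
    simp only [pPotential, smul_eq_mul]
    have : p - 1 ≠ 0 := by linarith
    field_simp
  have hs : ∀ t : ℝ, pPotential p (a + (0 : ℝ) • b) + t * (b ⬝ᵥ w) ≤ pPotential p (a + t • b) :=
    fun t => by
      have := dotProduct_le_pPotential_add_qReg hpq (a + t • b) w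
      rw [add_dotProduct, smul_dotProduct, smul_eq_mul] at this
      rw [zero_smul, add_zero]
      linarith
  simpa using le_of_concaveOn_sub_sq_of_subgradient hc hs

end Smoothness

/-! ### Pinsker's inequality and Gibbs distributions. -/

section Entropy

/-- Pointwise form of Pinsker. Divided by 2x + 4, the difference of the sides is convex on x > 0 and
vanishes with its derivative at 1. -/
theorem three_mul_sub_one_sq_le {x : ℝ} (hx : 0 ≤ x) :
    3 * (x - 1) ^ 2 ≤ (2 * x + 4) * (x * Real.log x - x + 1) := by
  rcases hx.eq_or_lt with rfl | hx
  · norm_num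
  set f : ℝ → ℝ := fun x => x * Real.log x - x + 1 - 3 / 2 * (x - 4 + 9 * (x + 2)⁻¹) with hf
  have hf' : ∀ x ∈ Set.Ioi (0 : ℝ),
      HasDerivAt f (Real.log x - 3 / 2 * (1 - 9 * ((x + 2) ^ 2)⁻¹)) x := fun x hx => by
    have hx : 0 < x := hx
    have h2 : x + 2 ≠ 0 := by positivity
    have h1 := (((Real.hasDerivAt_mul_log hx.ne').sub (hasDerivAt_id x)).add_const 1).sub
      ((((hasDerivAt_id x).sub_const 4).add
        ((((hasDerivAt_id x).add_const 2).inv h2).const_mul 9)).const_mul (3 / 2))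
    refine h1.congr_deriv ?_
    simp only [id]
    field_simp
    ring
  have hf'' : ∀ x ∈ Set.Ioi (0 : ℝ),
      HasDerivAt (fun x => Real.log x - 3 / 2 * (1 - 9 * ((x + 2) ^ 2)⁻¹))
        (x⁻¹ - 27 / (x + 2) ^ 3) x := fun x hx => by
    have hx : 0 < x := hx
    have h2 : (x + 2) ^ 2 ≠ 0 := by positivity
    have h1 := (Real.hasDerivAt_log hx.ne').sub
      (((((((hasDerivAt_id x).add_const 2).fun_pow 2).inv h2).const_mul 9).const_sub 1).const_mul
        (3 / 2))
    refine h1.congr_deriv ?_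
    simp only [id]
    field_simp
    ring
  have hconv : ConvexOn ℝ (Set.Ioi 0) f := by
    refine convexOn_of_hasDerivWithinAt2_nonneg (convex_Ioi 0)
      (fun x hx => (hf' x hx).continuousAt.continuousWithinAt)
      (fun x hx => (hf' x (interior_subset hx)).hasDerivWithinAt)
      (fun x hx => (hf'' x (interior_subset hx)).hasDerivWithinAt) fun x hx => ?_
    have hx : 0 < x := interior_subset hx
    rw [sub_nonneg, inv_eq_one_div, div_le_div_iff₀ (by positivity) hx]
    -- (x + 2)³ - 27x = (x - 1)²(x + 8).
    nlinarith [mul_nonneg (by linarith : 0 ≤ x + 8) (sq_nonneg (x - 1))]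
  have hmin : IsMinOn f (Set.Ioi 0) 1 := by
    refine hconv.isMinOn_of_rightDeriv_eq_zero (by simp) ?_
    have := (hf' 1 (by simp)).hasDerivWithinAt (s := Set.Ioi 1)
    rw [this.derivWithin (uniqueDiffWithinAt_Ioi 1)]
    norm_num
  have h := hmin (Set.mem_Ioi.2 hx)
  have h1 : f 1 = 0 := by norm_num [hf]
  have h2 : 0 ≤ f x := h1 ▸ h
  have h3 : (2 * x + 4) * f x
      = (2 * x + 4) * (x * Real.log x - x + 1) - 3 * (x - 1) ^ 2 := by
    simp only [hf]
    field_simp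
    ring
  have := mul_nonneg (by linarith : 0 ≤ 2 * x + 4) h2
  linarith

variable {n : ℕ}

/-- **Pinsker's inequality** on a finite simplex. -/
theorem sq_sum_abs_sub_le {u z : Fin n → ℝ} (hu : u ∈ stdSimplex ℝ (Fin n))
    (hz : z ∈ stdSimplex ℝ (Fin n)) (hpos : ∀ i, 0 < z i) :
    (∑ i, |u i - z i|) ^ 2 / 2 ≤ ∑ i, (u i * Real.log (u i) - u i * Real.log (z i)) := by
  have hlog : ∀ i, z i * (u i / z i * Real.log (u i / z i) - u i / z i + 1)
      = u i * Real.log (u i) - u i * Real.log (z i) - u i + z i := fun i => by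
    have hzi := (hpos i).ne'
    rcases (hu.1 i).eq_or_lt with h | h
    · simp [← h]
    · rw [Real.log_div h.ne' hzi]
      field_simp
  have hD : ∑ i, z i * (u i / z i * Real.log (u i / z i) - u i / z i + 1)
      = ∑ i, (u i * Real.log (u i) - u i * Real.log (z i)) := by
    simp only [hlog, sum_add_distrib, sum_sub_distrib, hu.2, hz.2]
    ring
  have hB : ∑ i, (2 * u i + 4 * z i) / 3 = 2 := by
    rw [← sum_div, sum_add_distrib, ← mul_sum, ← mul_sum, hu.2, hz.2]
    norm_num
  -- Cauchy–Schwarz against weights of total mass 2, the source of the factor 1/2; the termwise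
  -- bound is the pointwise inequality at x = u i / z i.
  have hCS := sum_sq_le_sum_mul_sum_of_sq_le_mul univ
    (r := fun i => |u i - z i|) (f := fun i => (2 * u i + 4 * z i) / 3)
    (g := fun i => z i * (u i / z i * Real.log (u i / z i) - u i / z i + 1))
    (fun i _ => by have := hu.1 i; have := hz.1 i; positivity)
    (fun i _ => mul_nonneg (hpos i).le (by
      have h0 : 0 ≤ u i / z i := div_nonneg (hu.1 i) (hpos i).le
      have := three_mul_sub_one_sq_le h0
      exact nonneg_of_mul_nonneg_right (le_trans (by positivity) this) (by positivity)))
    (fun i _ => by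
      have h0 : 0 ≤ u i / z i := div_nonneg (hu.1 i) (hpos i).le
      have h := mul_le_mul_of_nonneg_left (three_mul_sub_one_sq_le h0)
        (by positivity : 0 ≤ z i ^ 2 / 3)
      have hzi := (hpos i).ne'
      rw [sq_abs]
      refine le_trans (le_of_eq ?_) (h.trans (le_of_eq ?_)) <;> field_simp)
  rw [hB, hD] at hCS
  linarith

theorem uniform_mem_stdSimplex (hn : 0 < n) : uniform n ∈ stdSimplex ℝ (Fin n) := by
  refine ⟨fun i => by simp [uniform], ?_⟩
  simp [uniform, hn.ne']

/-- The gradient of the entropy at the uniform point is a constant vector, orthogonal to differences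
of simplex points. -/
theorem bregman_negEntropy_uniform (hn : 0 < n) {u : Fin n → ℝ}
    (hu : u ∈ stdSimplex ℝ (Fin n)) :
    bregman negEntropy u (uniform n) = negEntropy u + Real.log n := by
  have hn' : (1 / (n : ℝ)) ≠ 0 := by positivity
  have hd : HasFDerivAt (negEntropy (n := n))
      (∑ i, (Real.log (1 / n) + 1) • (ContinuousLinearMap.proj i : (Fin n → ℝ) →L[ℝ] ℝ))
      (uniform n) := by
    refine HasFDerivAt.fun_sum fun i _ => ?_
    exact HasDerivAt.comp_hasFDerivAt (uniform n) (Real.hasDerivAt_mul_log hn')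
      (hasFDerivAt_apply i (uniform n))
  have hsub : ∑ i, (u - uniform n) i = 0 := by
    simp only [Pi.sub_apply, sum_sub_distrib, hu.2, (uniform_mem_stdSimplex hn).2, sub_self]
  have h0 : negEntropy (uniform n) = -Real.log n := by
    have : (n : ℝ) ≠ 0 := by positivity
    simp [negEntropy, uniform, this]
  rw [bregman, hd.fderiv, h0]
  simp only [_root_.sum_apply, _root_.smul_apply,
    ContinuousLinearMap.proj_apply, smul_eq_mul, ← mul_sum, hsub]
  ring

theorem negEntropy_nonpos {u : Fin n → ℝ} (hu : u ∈ stdSimplex ℝ (Fin n)) :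
    negEntropy u ≤ 0 :=
  sum_nonpos fun i _ => Real.mul_log_nonpos (hu.1 i)
    (hu.2 ▸ single_le_sum (f := u) (fun _ _ => hu.1 _) (mem_univ i))

/-- The Gibbs distribution with energies `L`. -/
noncomputable def gibbs (L : Fin n → ℝ) : Fin n → ℝ :=
  fun i => Real.exp (-L i) / ∑ j, Real.exp (-L j)

theorem gibbs_pos (L : Fin n → ℝ) (i : Fin n) : 0 < gibbs L i :=
  div_pos (Real.exp_pos _) (sum_pos (fun _ _ => Real.exp_pos _) ⟨i, mem_univ i⟩)

theorem gibbs_mem_stdSimplex (hn : 0 < n) (L : Fin n → ℝ) :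
    gibbs L ∈ stdSimplex ℝ (Fin n) := by
  refine ⟨fun i => (gibbs_pos L i).le, ?_⟩
  have : 0 < ∑ j, Real.exp (-L j) := sum_pos (fun _ _ => Real.exp_pos _) ⟨⟨0, hn⟩, mem_univ _⟩
  simp only [gibbs]
  rw [← sum_div, div_self this.ne']

theorem gibbs_zero : gibbs (0 : Fin n → ℝ) = uniform n := by
  funext i
  simp [gibbs, uniform]

/-- The free energy exceeds its minimum by at least half the squared `ℓ₁`-distance to the Gibbs
distribution. -/
theorem add_sq_le_dotProduct_add_negEntropy (hn : 0 < n) (L : Fin n → ℝ) {u : Fin n → ℝ}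
    (hu : u ∈ stdSimplex ℝ (Fin n)) :
    L ⬝ᵥ gibbs L + negEntropy (gibbs L) + (∑ i, |u i - gibbs L i|) ^ 2 / 2
      ≤ L ⬝ᵥ u + negEntropy u := by
  have hZ : 0 < ∑ j, Real.exp (-L j) := sum_pos (fun _ _ => Real.exp_pos _) ⟨⟨0, hn⟩, mem_univ _⟩
  set c := Real.log (∑ j, Real.exp (-L j)) with hc
  have hlog : ∀ i, Real.log (gibbs L i) = -L i - c := fun i => by
    rw [gibbs, Real.log_div (Real.exp_pos _).ne' hZ.ne', Real.log_exp]
  have hcross : ∀ v ∈ stdSimplex ℝ (Fin n), ∑ i, v i * Real.log (gibbs L i) = -(L ⬝ᵥ v) - c :=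
    fun v hv => by
      calc ∑ i, v i * Real.log (gibbs L i) = ∑ i, (-(L i * v i) - v i * c) :=
            sum_congr rfl fun i _ => by rw [hlog]; ring
        _ = -(L ⬝ᵥ v) - c := by
            rw [sum_sub_distrib, sum_neg_distrib, ← sum_mul, hv.2, one_mul, dotProduct]
  have hP := sq_sum_abs_sub_le hu (gibbs_mem_stdSimplex hn L) (gibbs_pos L)
  rw [sum_sub_distrib, hcross u hu] at hP
  have hg : negEntropy (gibbs L) = -(L ⬝ᵥ gibbs L) - c :=
    hcross _ (gibbs_mem_stdSimplex hn L)
  have hu' : negEntropy u = ∑ i, u i * Real.log (u i) := rfl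
  linarith

end Entropy

/-! ### Closed forms of the two players' moves and existence of a run. -/

section Game

variable {n d : ℕ} (A : Matrix (Fin n) (Fin d) ℝ)

theorem payoff_eq_vecMul_dotProduct (w : Fin d → ℝ) (v : Fin n → ℝ) :
    payoff A w v = (v ᵥ* A) ⬝ᵥ w :=
  Matrix.dotProduct_mulVec _ _ _

theorem payoff_eq_mulVec_dotProduct (w : Fin d → ℝ) (v : Fin n → ℝ) :
    payoff A w v = (A *ᵥ w) ⬝ᵥ v :=
  dotProduct_comm _ _

theorem margin_le_payoff (w : Fin d → ℝ) {v : Fin n → ℝ} (hv : v ∈ stdSimplex ℝ (Fin n)) :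
    margin A w ≤ payoff A w v := by
  refine csInf_le ?_ ⟨v, hv, rfl⟩
  refine ((isCompact_stdSimplex ℝ (Fin n)).image_of_continuousOn ?_).bddBelow
  refine Continuous.continuousOn ?_
  unfold payoff dotProduct
  fun_prop

theorem lpNorm_vecMul_le {p : ℝ} (hp : 1 ≤ p) (hA : ∀ i, lpNorm p (A i) ≤ 1) (v : Fin n → ℝ) :
    lpNorm p (v ᵥ* A) ≤ ∑ i, |v i| := by
  rw [Matrix.vecMul_eq_sum]
  refine (lpNorm_sum_smul_le hp _ _ _).trans (sum_le_sum fun i _ => ?_)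
  exact mul_le_of_le_one_right (abs_nonneg _) (hA i)

theorem lpNorm_dataMatrix_row_le {p : ℝ} (hp : 1 ≤ p) {x : Fin n → Fin d → ℝ} {y : Fin n → ℝ}
    (hy : ∀ i, y i = 1 ∨ y i = -1) (hx : ∀ i, lpNorm p (x i) ≤ 1) (i : Fin n) :
    lpNorm p (dataMatrix x y i) ≤ 1 := by
  have h : dataMatrix x y i = y i • x i := rfl
  have hy1 : |y i| = 1 := by rcases hy i with h | h <;> simp [h]
  rw [h, lpNorm_smul hp, hy1, one_mul]
  exact hx i

/-- The origin minimizes the regularizer, so its derivative there is zero. -/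
theorem bregman_qReg_zero {p q : ℝ} (hpq : p.HolderConjugate q) (u : Fin d → ℝ) :
    bregman (qReg q) u 0 = qReg q u := by
  have h0 : qReg q (0 : Fin d → ℝ) = 0 := by
    simp [qReg_eq hpq, lpNorm_zero hpq.symm.lt.le]
  have hmin : IsLocalMin (qReg q) (0 : Fin d → ℝ) := Filter.Eventually.of_forall fun v => by
    have := hpq.sub_one_pos
    rw [h0, qReg_eq hpq]
    positivity
  simp [bregman, h0, hmin.fderiv_eq_zero]

/-- The sum `∑_{j=1}^{t-1} Aᵀ π_j + Aᵀ π_{t-1}` of the past gradients and of the hint. -/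
noncomputable def hintedGradient (π : ℕ → Fin n → ℝ) (t : ℕ) : Fin d → ℝ :=
  ∑ j ∈ Ico 1 t, π j ᵥ* A + π (t - 1) ᵥ* A

/-- The cumulative loss vector `∑_{j=1}^t A w_j`. -/
noncomputable def cumulativeLoss (w : ℕ → Fin d → ℝ) (t : ℕ) : Fin n → ℝ :=
  ∑ j ∈ Icc 1 t, A *ᵥ w j

/-- Up to a constant the objective is the Fenchel–Young gap, whose minimum 0 is attained; minimizers
are exactly the equality cases. -/
theorem isOFTRL_iff {p q : ℝ} (hpq : p.HolderConjugate q) (η : ℝ) (π : ℕ → Fin n → ℝ) (t : ℕ)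
    (z : Fin d → ℝ) :
    IsOFTRL (qReg q) 0 (fun u => -payoff A u (π (t - 1))) η Set.univ (fun _ => 1)
      (fun j u => -payoff A u (π j)) t z ↔
    (η • hintedGradient A π t) ⬝ᵥ z = pPotential p (η • hintedGradient A π t) + qReg q z := by
  have hobj : ∀ u : Fin d → ℝ, η * (∑ j ∈ Ico 1 t, 1 * -payoff A u (π j)
      + 1 * -payoff A u (π (t - 1))) + bregman (qReg q) u 0
      = qReg q u - (η • hintedGradient A π t) ⬝ᵥ u := fun u => by
    simp only [bregman_qReg_zero hpq, hintedGradient, payoff_eq_vecMul_dotProduct, one_mul,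
      smul_dotProduct, add_dotProduct, sum_dotProduct, sum_neg_distrib, smul_eq_mul]
    ring
  simp only [IsOFTRL, IsArgmin, hobj, Set.mem_univ, true_and, forall_true_left]
  constructor
  · intro h
    obtain ⟨v, hv⟩ := exists_dotProduct_eq_pPotential_add_qReg hpq (η • hintedGradient A π t)
    have := dotProduct_le_pPotential_add_qReg hpq (η • hintedGradient A π t) z
    linarith [h v]
  · intro h u
    linarith [dotProduct_le_pPotential_add_qReg hpq (η • hintedGradient A π t) u]

/-- The quadratic gap in the free energy gives minimality and uniqueness at once. -/
theorem isFTRLPlus_iff (hn : 0 < n) (η : ℝ) (w : ℕ → Fin d → ℝ) (t : ℕ) (z : Fin n → ℝ) :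
    IsFTRLPlus negEntropy (uniform n) η (stdSimplex ℝ (Fin n)) (fun _ => 1)
      (fun j u => payoff A (w j) u) t z ↔ z = gibbs (η • cumulativeLoss A w t) := by
  have hobj : ∀ u ∈ stdSimplex ℝ (Fin n), η * ∑ j ∈ Icc 1 t, 1 * payoff A (w j) u
      + bregman negEntropy u (uniform n)
      = (η • cumulativeLoss A w t) ⬝ᵥ u + negEntropy u + Real.log n := fun u hu => by
    simp only [bregman_negEntropy_uniform hn hu, cumulativeLoss, payoff_eq_mulVec_dotProduct,
      one_mul, smul_dotProduct, sum_dotProduct, smul_eq_mul]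
    ring
  have hgap := fun u hu => add_sq_le_dotProduct_add_negEntropy hn (η • cumulativeLoss A w t)
    (u := u) hu
  have hmem := gibbs_mem_stdSimplex hn (η • cumulativeLoss A w t)
  constructor
  · rintro ⟨hz, h⟩
    have h1 := h _ hmem
    simp only [hobj z hz, hobj _ hmem] at h1
    have h2 := hgap z hz
    have h3 : ∑ i, |z i - gibbs (η • cumulativeLoss A w t) i| = 0 := by
      rw [← sq_eq_zero_iff]
      exact le_antisymm (by linarith) (sq_nonneg _)
    rw [sum_eq_zero_iff_of_nonneg fun i _ => abs_nonneg _] at h3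
    funext i
    exact sub_eq_zero.1 (abs_eq_zero.1 (h3 i (mem_univ i)))
  · rintro rfl
    refine ⟨hmem, fun u hu => ?_⟩
    simp only [hobj u hu, hobj _ hmem]
    have h2 := hgap u hu
    have := sq_nonneg (∑ i, |u i - gibbs (η • cumulativeLoss A w t) i|)
    linarith

theorem hintedGradient_congr {π π' : ℕ → Fin n → ℝ} {t : ℕ} (ht : 1 ≤ t)
    (h : ∀ j < t, π j = π' j) : hintedGradient A π t = hintedGradient A π' t := by
  rw [hintedGradient, hintedGradient, h (t - 1) (by omega)]
  congr 1
  exact sum_congr rfl fun j hj => by rw [h j (mem_Ico.1 hj).2]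

theorem cumulativeLoss_congr {w w' : ℕ → Fin d → ℝ} {t : ℕ} (h : ∀ j ≤ t, w j = w' j) :
    cumulativeLoss A w t = cumulativeLoss A w' t :=
  sum_congr rfl fun j hj => by rw [h j (mem_Icc.1 hj).2]

theorem isRun_iff (hn : 0 < n) {p q : ℝ} (hpq : p.HolderConjugate q) (ηw ηp : ℝ) (T : ℕ)
    (w : ℕ → Fin d → ℝ) (π : ℕ → Fin n → ℝ) :
    IsRun A q ηw ηp (fun _ => 1) T w π ↔ π 0 = uniform n ∧ ∀ t ∈ Icc 1 T,
      ((ηw • hintedGradient A π t) ⬝ᵥ w t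
        = pPotential p (ηw • hintedGradient A π t) + qReg q (w t)) ∧
      π t = gibbs (ηp • cumulativeLoss A w t) := by
  constructor
  · rintro ⟨h0, hw, hπ⟩
    exact ⟨h0, fun t ht => ⟨(isOFTRL_iff A hpq ηw π t _).1 (hw t ht),
      (isFTRLPlus_iff A hn ηp w t _).1 (hπ t ht)⟩⟩
  · rintro ⟨h0, h⟩
    exact ⟨h0, fun t ht => (isOFTRL_iff A hpq ηw π t _).2 (h t ht).1,
      fun t ht => (isFTRLPlus_iff A hn ηp w t _).2 (h t ht).2⟩

/-- The condition on w_t involves only earlier π, and that on π_t only w up to t, so a run extends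
by one round without disturbing the past. -/
theorem exists_isRun (hn : 0 < n) {p q : ℝ} (hpq : p.HolderConjugate q) (ηw ηp : ℝ) (T : ℕ) :
    ∃ (w : ℕ → Fin d → ℝ) (π : ℕ → Fin n → ℝ), IsRun A q ηw ηp (fun _ => 1) T w π := by
  simp only [isRun_iff A hn hpq]
  induction T with
  | zero => exact ⟨0, fun _ => uniform n, rfl, by simp⟩
  | succ T ih =>
    obtain ⟨w, π, h0, h⟩ := ih
    obtain ⟨v, hv⟩ := exists_dotProduct_eq_pPotential_add_qReg hpq
      (ηw • hintedGradient A π (T + 1))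
    set w' := Function.update w (T + 1) v with hw'
    set π' := Function.update π (T + 1) (gibbs (ηp • cumulativeLoss A w' (T + 1))) with hπ'
    have hwlt : ∀ j < T + 1, w j = w' j := fun j hj => by
      rw [hw', Function.update_of_ne hj.ne]
    have hπlt : ∀ j < T + 1, π j = π' j := fun j hj => by
      rw [hπ', Function.update_of_ne hj.ne]
    refine ⟨w', π', (hπlt 0 (by omega)).symm.trans h0, fun t ht => ?_⟩
    obtain ⟨ht1, htT⟩ := mem_Icc.1 ht
    rw [← hintedGradient_congr A ht1 fun j hj => hπlt j (by omega)]
    rcases htT.eq_or_lt with rfl | htT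
    · rw [hw', hπ', Function.update_self, Function.update_self]
      exact ⟨hv, rfl⟩
    · rw [← hwlt t htT, ← hπlt t htT,
        ← cumulativeLoss_congr A fun j hj => hwlt j (by omega)]
      exact h t (mem_Icc.2 ⟨ht1, by omega⟩)

/-! ### Cancellation of the stability terms and the margin bound. -/

variable {A}

/-- The potential of the `w`-player is controlled by the free energy of the `p`-player: the
stability terms of the two players cancel when `ηp = 1 / ηw`. -/
theorem pPotential_le_of_isRun (hn : 0 < n) {p q : ℝ} (hp : 2 ≤ p) (hpq : p.HolderConjugate q)
    (hA : ∀ i, lpNorm p (A i) ≤ 1) {η : ℝ} (hη : 0 < η) {T : ℕ}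
    {w : ℕ → Fin d → ℝ} {π : ℕ → Fin n → ℝ}
    (hrun : IsRun A q η (1 / η) (fun _ => 1) T w π) {t : ℕ} (ht : t ≤ T) :
    pPotential p (η • ∑ j ∈ Icc 1 t, π j ᵥ* A) ≤
      η ^ 2 * (((1 / η) • cumulativeLoss A w t) ⬝ᵥ π t + negEntropy (π t) + Real.log n) := by
  obtain ⟨h0, h⟩ := (isRun_iff A hn hpq _ _ _ _ _).1 hrun
  -- Round 0 is included: the uniform start is the Gibbs point of zero loss, so the entropy gap also
  -- applies to the first step.
  have hπ : ∀ s ≤ T, π s = gibbs ((1 / η) • cumulativeLoss A w s) := fun s hs => by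
    rcases Nat.eq_zero_or_pos s with rfl | hs0
    · rw [h0, ← gibbs_zero]
      simp [cumulativeLoss]
    · exact (h s (mem_Icc.2 ⟨hs0, hs⟩)).2
  induction t with
  | zero =>
    have hn' : (n : ℝ) ≠ 0 := by positivity
    simp [cumulativeLoss, h0, pPotential_zero hpq.lt.le, negEntropy, uniform, hn']
  | succ t ih =>
    have ih := ih (by omega)
    set S := ∑ j ∈ Icc 1 t, π j ᵥ* A with hS
    set L := cumulativeLoss A w t with hL
    set D := ∑ i, |π (t + 1) i - π t i| with hD
    have hw := (h (t + 1) (mem_Icc.2 ⟨by omega, ht⟩)).1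
    -- `Ico 1 (t + 1)` is `Icc 1 t` by definition. `π 0` enters only as a hint, never in `S`.
    have hθ : hintedGradient A π (t + 1) = S + π t ᵥ* A := rfl
    rw [hθ] at hw
    have hS1 : ∑ j ∈ Icc 1 (t + 1), π j ᵥ* A = S + π (t + 1) ᵥ* A :=
      sum_Icc_succ_top (by omega) _
    have hL1 : cumulativeLoss A w (t + 1) = L + A *ᵥ w (t + 1) :=
      sum_Icc_succ_top (by omega) _
    have hsplit : η • (S + π (t + 1) ᵥ* A)
        = η • (S + π t ᵥ* A) + η • ((π (t + 1) - π t) ᵥ* A) := by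
      rw [Matrix.sub_vecMul]
      module
    have hsmooth := pPotential_add_le hp hpq hw (η • ((π (t + 1) - π t) ᵥ* A))
    rw [← hsplit] at hsmooth
    have hnorm : lpNorm p (η • ((π (t + 1) - π t) ᵥ* A)) ^ 2 ≤ η ^ 2 * D ^ 2 := by
      rw [lpNorm_smul hpq.lt.le, mul_pow, sq_abs]
      gcongr
      · exact lpNorm_nonneg hpq.lt.le _
      · exact lpNorm_vecMul_le A hpq.lt.le hA _
    have hfy := dotProduct_le_pPotential_add_qReg hpq (η • S) (w (t + 1))
    have hent := add_sq_le_dotProduct_add_negEntropy hn ((1 / η) • L)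
      (u := π (t + 1)) (hπ _ ht ▸ gibbs_mem_stdSimplex hn _)
    rw [← hπ t (by omega), ← hD] at hent
    rw [Matrix.sub_vecMul] at hnorm
    rw [hS1, hL1]
    have hcomm : (A *ᵥ w (t + 1)) ⬝ᵥ π (t + 1) = (π (t + 1) ᵥ* A) ⬝ᵥ w (t + 1) := by
      rw [← payoff_eq_mulVec_dotProduct, payoff_eq_vecMul_dotProduct]
    simp only [smul_dotProduct, add_dotProduct, smul_eq_mul, Matrix.sub_vecMul,
      sub_dotProduct] at hw hsmooth hfy hent ih ⊢
    rw [hcomm]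
    have hent' := mul_le_mul_of_nonneg_left hent (sq_nonneg η)
    have hcancel : η ^ 2 * (1 / η * ((π (t + 1) ᵥ* A) ⬝ᵥ w (t + 1)))
        = η * ((π (t + 1) ᵥ* A) ⬝ᵥ w (t + 1)) := by
      field_simp
    -- `hw`, `hsmooth` and `hfy` raise the left side by at most η π_{t+1}ᵀA w_{t+1} + η²D²/2, and
    -- `hent'` raises the right side by at least as much.
    linarith

/-- The regret bound of the game, with comparators `u` and `v`. -/
theorem sum_payoff_sub_qReg_le (hn : 0 < n) {p q : ℝ} (hp : 2 ≤ p) (hpq : p.HolderConjugate q)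
    (hA : ∀ i, lpNorm p (A i) ≤ 1) {η : ℝ} (hη : 0 < η) {T : ℕ}
    {w : ℕ → Fin d → ℝ} {π : ℕ → Fin n → ℝ}
    (hrun : IsRun A q η (1 / η) (fun _ => 1) T w π) (hT : 1 ≤ T) (u : Fin d → ℝ) {v : Fin n → ℝ}
    (hv : v ∈ stdSimplex ℝ (Fin n)) :
    η * ∑ t ∈ Icc 1 T, payoff A u (π t) - qReg q u
      ≤ η * ∑ t ∈ Icc 1 T, payoff A (w t) v + η ^ 2 * Real.log n := by
  have h1 := pPotential_le_of_isRun hn hp hpq hA hη hrun le_rfl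
  have h2 := dotProduct_le_pPotential_add_qReg hpq (η • ∑ j ∈ Icc 1 T, π j ᵥ* A) u
  have hπ := (((isRun_iff A hn hpq _ _ _ _ _).1 hrun).2 T (mem_Icc.2 ⟨hT, le_rfl⟩)).2
  have h3 := add_sq_le_dotProduct_add_negEntropy hn ((1 / η) • cumulativeLoss A w T) hv
  rw [← hπ] at h3
  have h4 := negEntropy_nonpos hv
  have h5 := sq_nonneg (∑ i, |v i - π T i|)
  have h6 : ((1 / η) • cumulativeLoss A w T) ⬝ᵥ π T + negEntropy (π T) + Real.log n
      ≤ ((1 / η) • cumulativeLoss A w T) ⬝ᵥ v + Real.log n := by linarith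
  have h7 := mul_le_mul_of_nonneg_left h6 (sq_nonneg η)
  have h8 : ((1 / η) • cumulativeLoss A w T) ⬝ᵥ v
      = 1 / η * ∑ t ∈ Icc 1 T, payoff A (w t) v := by
    simp only [cumulativeLoss, smul_dotProduct, sum_dotProduct, payoff_eq_mulVec_dotProduct,
      smul_eq_mul]
  have h9 : (η • ∑ j ∈ Icc 1 T, π j ᵥ* A) ⬝ᵥ u = η * ∑ t ∈ Icc 1 T, payoff A u (π t) := by
    simp only [smul_dotProduct, sum_dotProduct, payoff_eq_vecMul_dotProduct, smul_eq_mul]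
  rw [h8] at h7
  rw [h9] at h2
  have h10 : η ^ 2 * (1 / η * ∑ t ∈ Icc 1 T, payoff A (w t) v + Real.log n)
      = η * ∑ t ∈ Icc 1 T, payoff A (w t) v + η ^ 2 * Real.log n := by
    field_simp
  linarith

theorem payoff_average (T : ℕ) (w : ℕ → Fin d → ℝ) (v : Fin n → ℝ) :
    payoff A (average (fun _ => 1) T w) v = (T : ℝ)⁻¹ * ∑ t ∈ Icc 1 T, payoff A (w t) v := by
  simp [average, payoff_eq_vecMul_dotProduct, dotProduct_smul, dotProduct_sum]

theorem margin_average_nonneg (hn : 0 < n) {p q : ℝ} (hp : 2 ≤ p) (hpq : p.HolderConjugate q)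
    (hA : ∀ i, lpNorm p (A i) ≤ 1) {η : ℝ} (hη : 0 < η) {T : ℕ} (hT : 1 ≤ T)
    {w : ℕ → Fin d → ℝ} {π : ℕ → Fin n → ℝ}
    (hrun : IsRun A q η (1 / η) (fun _ => 1) T w π) {γ : ℝ} {u : Fin d → ℝ}
    (hγ : 0 ≤ γ) (hu : lpNorm q u ≤ 1) (hm : γ ≤ margin A u)
    (hTγ : 2 * (p - 1) * Real.log n ≤ (T * γ) ^ 2) :
    0 ≤ margin A (average (fun _ => 1) T w) := by
  refine Real.sInf_nonneg ?_
  rintro _ ⟨v, hv, rfl⟩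
  simp only [payoff_average]
  refine mul_nonneg (by positivity) ?_
  have hp1 : 0 < p - 1 := by linarith
  have h0 := (isRun_iff A hn hpq _ _ _ _ _).1 hrun
  -- Maximizer of ηTcγ - (p-1)c²/2, the lower bound obtained from the comparator c·u.
  set c := T * γ * η / (p - 1) with hc
  have hc0 : 0 ≤ c := by positivity
  have hreg := sum_payoff_sub_qReg_le hn hp hpq hA hη hrun hT (c • u) hv
  have hlow : T * (c * γ) ≤ ∑ t ∈ Icc 1 T, payoff A (c • u) (π t) := by
    have : ∀ t ∈ Icc 1 T, c * γ ≤ payoff A (c • u) (π t) := fun t ht => by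
      rw [payoff_eq_vecMul_dotProduct, dotProduct_smul, ← payoff_eq_vecMul_dotProduct, smul_eq_mul]
      refine mul_le_mul_of_nonneg_left (hm.trans (margin_le_payoff A u ?_)) hc0
      rw [(h0.2 t ht).2]
      exact gibbs_mem_stdSimplex hn _
    simpa using card_nsmul_le_sum _ _ _ this
  have hR : qReg q (c • u) ≤ (p - 1) / 2 * c ^ 2 := by
    rw [qReg_eq hpq, lpNorm_smul hpq.symm.lt.le, mul_pow, sq_abs]
    have := pow_le_one₀ (n := 2) (lpNorm_nonneg hpq.symm.lt.le u) hu
    have := mul_le_of_le_one_right (sq_nonneg c) this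
    gcongr
  have hlow' := mul_le_mul_of_nonneg_left hlow hη.le
  have hval : η * (T * (c * γ)) - (p - 1) / 2 * c ^ 2 = η ^ 2 * ((T * γ) ^ 2 / (2 * (p - 1))) := by
    rw [hc]
    field_simp
    ring
  have hlog : Real.log n ≤ (T * γ) ^ 2 / (2 * (p - 1)) := by
    rw [le_div_iff₀ (by positivity)]
    linarith
  have hlog' := mul_le_mul_of_nonneg_left hlog (sq_nonneg η)
  exact nonneg_of_mul_nonneg_right (by linarith :
    0 ≤ η * ∑ t ∈ Icc 1 T, payoff A (w t) v) hη

end Game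

end PNormPerceptron
theorem theorem6 {n d : ℕ} (hn : 2 ≤ n)
    (x : Fin n → Fin d → ℝ) (y : Fin n → ℝ) (hy : ∀ i, y i = 1 ∨ y i = -1)
    (p q : ℝ) (hp : 2 ≤ p) (hpq : 1 / p + 1 / q = 1)
    (hx : ∀ i, PNormPerceptron.lpNorm p (x i) ≤ 1)
    (γ : ℝ) (hγ : 0 < γ)
    (hsep : ∃ wstar : Fin d → ℝ, PNormPerceptron.lpNorm q wstar ≤ 1 ∧
      γ ≤ PNormPerceptron.margin (PNormPerceptron.dataMatrix x y) wstar)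
    (α : ℕ → ℝ) (hα : ∀ t, α t = 1)
    (ηw ηp : ℝ) (hηw : ηw = Real.sqrt (1 / (2 * (q - 1) * Real.log n))) (hηp : ηp = 1 / ηw)
    (T : ℕ) (hT : Real.sqrt (2 * (p - 1) * Real.log n) / γ ≤ T) :
    (∃ (w : ℕ → Fin d → ℝ) (π : ℕ → Fin n → ℝ),
      PNormPerceptron.IsRun (PNormPerceptron.dataMatrix x y) q ηw ηp α T w π) ∧
    ∀ (w : ℕ → Fin d → ℝ) (π : ℕ → Fin n → ℝ),
      PNormPerceptron.IsRun (PNormPerceptron.dataMatrix x y) q ηw ηp α T w π →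
      0 ≤ PNormPerceptron.margin (PNormPerceptron.dataMatrix x y)
        (PNormPerceptron.average α T w) := by
  obtain rfl : α = fun _ => 1 := funext hα
  have hq0 : q ≠ 0 := by
    rintro rfl
    rw [div_zero, add_zero, div_eq_iff (by linarith)] at hpq
    linarith
  have hc : p.HolderConjugate q := by
    rw [Real.holderConjugate_iff]
    exact ⟨by linarith, by simpa [one_div] using hpq⟩
  have hn0 : 0 < n := by omega
  have hq1 := hc.symm.sub_one_pos
  have hp1 := hc.sub_one_pos
  have hlog : 0 < Real.log n := Real.log_pos (by exact_mod_cast hn)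
  have hη : 0 < ηw := hηw ▸ Real.sqrt_pos.2 (by positivity)
  subst hηp
  refine ⟨PNormPerceptron.exists_isRun _ hn0 hc _ _ _, fun w π hrun => ?_⟩
  obtain ⟨u, hu, hm⟩ := hsep
  have hT' : Real.sqrt (2 * (p - 1) * Real.log n) ≤ T * γ := (div_le_iff₀ hγ).1 hT
  -- Since n ≥ 2 makes log n positive, the bound on T excludes the empty run.
  have hT1 : 1 ≤ T := by
    by_contra h
    obtain rfl : T = 0 := by omega
    have : 0 < Real.sqrt (2 * (p - 1) * Real.log n) := Real.sqrt_pos.2 (by positivity)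
    simp only [Nat.cast_zero, zero_mul] at hT'
    linarith
  exact PNormPerceptron.margin_average_nonneg hn0 hp hc
    (PNormPerceptron.lpNorm_dataMatrix_row_le hc.lt.le hy hx) hη hT1 hrun hγ.le hu hm
    ((Real.sqrt_le_left (by positivity)).1 hT')
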